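/- Let $\ell:\mathbb N\to\mathbb N$ with $\ell(n)\ge 1$, and let $\mathcal X(n)$ be finite domains. A \emph{balanced adversary} $A=(A_1,A_2)$, given for every $n$, consists of a randomized sampler $A_1$, which chooses a distribution $\mathcal D$ over $\mathcal X(n)$ and draws $n$ i.i.d. samples $\mathcal S\sim\mathcal D^n$ for the mechanism, and a randomized analyst $A_2$, whose coins are independent of those of $A_1$ and which gets no information from $A_1$. For $i=1,\dots,\ell(n)$ the analyst sends a query $q_i:\mathcal X(n)\to[-1,1]$, which may depend on its coins and on the previous messages, and the mechanism sends an answer $y_i\in[-1,1]$, which may depend on its own independent coins, on $\mathcal S$ and on the previous messages. Write $q(\mathcal D)=\mathbb E_{x\sim\mathcal D}[q(x)]$ and $q(\mathcal S)=\frac1n\sum_{x\in\mathcal S}q(x)$. No algorithm (sampler, analyst, mechanism, $F$, $G$ below) is computationally restricted. A function $\nu:\mathbb N\to\mathbb R$ is \emph{negligible} if for every $c>0$ one has $\nu(n)<n^{-c}$ for all large enough $n$; $\mathrm{neg}(n)$ denotes some negligible function. In a random execution in which the mechanism answers every query $q$ by its empirical mean $q(\mathcal S)$, let $D_n$ be the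 chosen distribution, $Q_n$ the last query, $T_n$ the transcript (all queries and answers), and $V_n$ the view of $A_2$ (its coins and $T_n$). Consider the following properties of $A$: 1. (The analyst knows the true value of its last query.) There is a randomized algorithm $F$ such that for all $n$, $\Pr[|F(V_n)-Q_n(D_n)|\le n^{-1/10}]\ge 1-\mathrm{neg}(n)$. 2. (The last query fails every unbounded last-round strategy.) For every randomized algorithm $G$ and all $n$, $\Pr[|G(T_n)-Q_n(D_n)|\le 1/10]\le 1/4+\mathrm{neg}(n)$. 2'. For every mechanism $M$ that answers every query except possibly the last one by its empirical mean, and for all $n$, the probability that in a random execution with $M$ the last answer $y_{\ell(n)}$ satisfies $|y_{\ell(n)}-q_{\ell(n)}(\mathcal D)|>1/10$ is at least $3/4-\mathrm{neg}(n)$. (The negligible functions in 2 and 2' may depend on $G$ and $M$.) Then no balanced adversary satisfies both 1 and 2, and no balanced adversary satisfies both 1 and 2'. -/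

import Mathlib

open MeasureTheory ProbabilityTheory Filter

noncomputable section

namespace ADA

/-- Answers, and values of statistical queries, are reals in `[-1, 1]`. -/
abbrev Answer : Type := Set.Icc (-1 : ℝ) 1

/-- A statistical query on the domain `X`. -/
abbrev Query (X : Type) : Type := X → Answer

/-- The messages exchanged by analyst and mechanism in `k` rounds: queries and answers. -/
abbrev Transcript (X : Type) (k : ℕ) : Type := (Fin k → Query X) × (Fin k → Answer)

/-- A computationally unbounded randomized algorithm: a measurable function of its random coins
and its input. -/
structure RandomizedAlgorithm (α β : Type) [MeasurableSpace α] [MeasurableSpace β] where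
  Coins : Type
  [measurableSpaceCoins : MeasurableSpace Coins]
  law : Measure Coins
  [isProbabilityMeasure_law : IsProbabilityMeasure law]
  run : Coins → α → β
  measurable_run : Measurable fun p : Coins × α => run p.1 p.2

attribute [instance] RandomizedAlgorithm.measurableSpaceCoins
  RandomizedAlgorithm.isProbabilityMeasure_law

/-- An unbounded sampler: it draws a random seed, and the seed selects a distribution on `X`. -/
structure Sampler (X : Type) [MeasurableSpace X] where
  Seed : Type
  [measurableSpaceSeed : MeasurableSpace Seed]
  law : Measure Seed
  [isProbabilityMeasure_law : IsProbabilityMeasure law]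
  dist : Kernel Seed X
  [isMarkovKernel_dist : IsMarkovKernel dist]

attribute [instance] Sampler.measurableSpaceSeed Sampler.isProbabilityMeasure_law
  Sampler.isMarkovKernel_dist

/-- An unbounded analyst asking `ℓ` adaptive queries: the query of round `i` (rounds are counted
from `0`) depends on its coins and on the answers to the `i` previous queries. The previous
queries are themselves determined by these data. -/
structure Analyst (X : Type) [MeasurableSpace X] (ℓ : ℕ) where
  Coins : Type
  [measurableSpaceCoins : MeasurableSpace Coins]
  law : Measure Coins
  [isProbabilityMeasure_law : IsProbabilityMeasure law]
  query : (i : Fin ℓ) → Coins → (Fin i.val → Answer) → Query X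
  measurable_query : ∀ i : Fin ℓ,
    Measurable fun p : Coins × (Fin i.val → Answer) => query i p.1 p.2

attribute [instance] Analyst.measurableSpaceCoins Analyst.isProbabilityMeasure_law

/-- A balanced adversary consists of a sampler and an analyst, with no communication from the
sampler to the analyst (see `execution`, where their coins are independent). -/
structure BalancedAdversary (X : Type) [MeasurableSpace X] (ℓ : ℕ) where
  sampler : Sampler X
  analyst : Analyst X ℓ

/-- An unbounded mechanism that gets `n` samples and answers `ℓ` queries: the answer in round `i`
depends on its coins, on the samples and on the queries received in rounds `0, …, i`. -/
structure Mechanism (X : Type) [MeasurableSpace X] (n ℓ : ℕ) where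
  Coins : Type
  [measurableSpaceCoins : MeasurableSpace Coins]
  law : Measure Coins
  [isProbabilityMeasure_law : IsProbabilityMeasure law]
  answer : (i : Fin ℓ) → Coins → (Fin n → X) → (Fin (i.val + 1) → Query X) → Answer
  measurable_answer : ∀ i : Fin ℓ,
    Measurable fun p : Coins × (Fin n → X) × (Fin (i.val + 1) → Query X) =>
      answer i p.1 p.2.1 p.2.2

attribute [instance] Mechanism.measurableSpaceCoins Mechanism.isProbabilityMeasure_law

/-- `n` i.i.d. samples from the distribution `κ ω`. -/
def iid {Ω X : Type} [MeasurableSpace Ω] [MeasurableSpace X] (κ : Kernel Ω X) [IsMarkovKernel κ]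
    (n : ℕ) : Kernel Ω (Fin n → X) where
  toFun ω := Measure.pi fun _ : Fin n => κ ω
  measurable' := by
    refine Measurable.measure_of_isPiSystem_of_isProbabilityMeasure
      generateFrom_pi.symm isPiSystem_pi ?_
    rintro s ⟨t, ht, rfl⟩
    simp only [Measure.pi_pi]
    exact Finset.measurable_prod _ fun i _ => κ.measurable_coe (ht i (Set.mem_univ i))

instance isMarkovKernel_iid {Ω X : Type} [MeasurableSpace Ω] [MeasurableSpace X] (κ : Kernel Ω X) [IsMarkovKernel κ]
    (n : ℕ) : IsMarkovKernel (iid κ n) :=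
  ⟨fun ω => inferInstanceAs (IsProbabilityMeasure (Measure.pi fun _ : Fin n => κ ω))⟩

/-- The empirical mean `q(S)` of a query on a sample. -/
def empiricalMean {X : Type} {n : ℕ} (q : Query X) (S : Fin n → X) : Answer :=
  ⟨(∑ j, (q (S j) : ℝ)) / n, by
    have h1 : ∑ j, (q (S j) : ℝ) ≤ n := by
      simpa using Finset.sum_le_sum fun j (_ : j ∈ Finset.univ) => (q (S j)).2.2
    have h2 : -(n : ℝ) ≤ ∑ j, (q (S j) : ℝ) := by
      simpa using Finset.sum_le_sum fun j (_ : j ∈ Finset.univ) => (q (S j)).2.1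
    rw [Set.mem_Icc, ← abs_le, abs_div, Nat.abs_cast]
    exact div_le_one_of_le₀ (abs_le.2 ⟨h2, h1⟩) n.cast_nonneg⟩

/-- The true value `q(D)`. -/
def trueMean {X : Type} [MeasurableSpace X] (q : Query X) (D : Measure X) : ℝ :=
  ∫ x, (q x : ℝ) ∂D

section Game

variable {X : Type} [MeasurableSpace X] {n ℓ : ℕ}

/-- The transcript of the first `k` rounds, for fixed coins `r` of the analyst, fixed coins `c` of
the mechanism and fixed samples `S`. -/
def play (A : Analyst X ℓ) (M : Mechanism X n ℓ) (r : A.Coins) (c : M.Coins) (S : Fin n → X) :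
    (k : ℕ) → k ≤ ℓ → Transcript X k
  | 0, _ => (Fin.elim0, Fin.elim0)
  | k + 1, hk =>
    let t := play A M r c S k (Nat.le_of_succ_le hk)
    let qs : Fin (k + 1) → Query X :=
      Fin.snoc (α := fun _ => Query X) t.1 (A.query ⟨k, hk⟩ r t.2)
    (qs, Fin.snoc (α := fun _ => Answer) t.2 (M.answer ⟨k, hk⟩ c S qs))

/-- The sample space of the game: seed of the sampler, samples, coins of the analyst and coins of
the mechanism. -/
abbrev Outcome (A : BalancedAdversary X ℓ) (M : Mechanism X n ℓ) : Type :=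
  (A.sampler.Seed × (Fin n → X)) × (A.analyst.Coins × M.Coins)

/-- The law of a random execution of the game: the sampler draws its seed and then `n` i.i.d.
samples from the chosen distribution; the coins of the analyst and of the mechanism are
independent of these and of each other. -/
def execution (A : BalancedAdversary X ℓ) (M : Mechanism X n ℓ) : Measure (Outcome A M) :=
  (A.sampler.law ⊗ₘ iid A.sampler.dist n).prod (A.analyst.law.prod M.law)

namespace Outcome

variable {A : BalancedAdversary X ℓ} {M : Mechanism X n ℓ}

/-- The distribution chosen by the sampler. -/
def dist (e : Outcome A M) : Measure X := A.sampler.dist e.1.1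

/-- The transcript of all `ℓ` rounds. -/
def transcript (e : Outcome A M) : Transcript X ℓ :=
  play A.analyst M e.2.1 e.2.2 e.1.2 ℓ le_rfl

/-- The view of the analyst: its coins and the transcript. -/
def view (e : Outcome A M) : A.analyst.Coins × Transcript X ℓ := (e.2.1, transcript e)

/-- The last query. -/
def lastQuery (hℓ : 0 < ℓ) (e : Outcome A M) : Query X :=
  (transcript e).1 ⟨ℓ - 1, Nat.sub_one_lt_of_lt hℓ⟩

/-- The last answer. -/
def lastAnswer (hℓ : 0 < ℓ) (e : Outcome A M) : Answer :=
  (transcript e).2 ⟨ℓ - 1, Nat.sub_one_lt_of_lt hℓ⟩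

/-- The true value of the last query. -/
def target (hℓ : 0 < ℓ) (e : Outcome A M) : ℝ := trueMean (lastQuery hℓ e) (dist e)

end Outcome

/-- The mechanism that answers every query with its empirical mean. -/
def empiricalMechanism (X : Type) [MeasurableSpace X] [Finite X] [DiscreteMeasurableSpace X]
    (n ℓ : ℕ) : Mechanism X n ℓ where
  Coins := Unit
  law := Measure.dirac ()
  answer i _ S qs := empiricalMean (qs (Fin.last i.val)) S
  isProbabilityMeasure_law := Measure.dirac.isProbabilityMeasure
  measurable_answer i := by
    have : Measurable fun p : (Fin (i.val + 1) → Query X) × (Fin n → X) =>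
        empiricalMean (p.1 (Fin.last i.val)) p.2 := by
      refine measurable_from_prod_countable_left fun S => ?_
      refine Measurable.subtype_mk (Measurable.div_const ?_ _)
      refine Finset.measurable_sum _ fun j _ => measurable_subtype_coe.comp ?_
      exact (measurable_pi_apply (S j)).comp (measurable_pi_apply (Fin.last i.val))
    exact this.comp ((measurable_snd.comp measurable_snd).prodMk
      (measurable_fst.comp measurable_snd))

/-- The mechanism answers with the empirical mean in all rounds except possibly the last one. -/
def Mechanism.EmpiricalBeforeLast (M : Mechanism X n ℓ) : Prop :=
  ∀ i : Fin ℓ, i.val + 1 < ℓ → ∀ c S qs, M.answer i c S qs = empiricalMean (qs (Fin.last i.val)) S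

end Game

/-- `ν(n) < n ^ (-c)` for every constant `c > 0` and all large enough `n`. -/
def Negligible (ν : ℕ → ℝ) : Prop :=
  ∀ c : ℝ, 0 < c → ∀ᶠ n : ℕ in atTop, ν n < (n : ℝ) ^ (-c)

section Structure

variable {X : ℕ → Type} [∀ n, MeasurableSpace (X n)] [∀ n, Finite (X n)]
  [∀ n, DiscreteMeasurableSpace (X n)] {ℓ : ℕ → ℕ}

/-- The analyst knows the true value of its last query: when the game is played with the empirical
mean mechanism, some unbounded extractor `F` computes this value from the view of the analyst, up
to `n ^ (-1/10)` and except with negligible probability. -/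
def KnowsLastValue (hℓ : ∀ n, 0 < ℓ n) (A : ∀ n, BalancedAdversary (X n) (ℓ n)) : Prop :=
  ∃ F : ∀ n, RandomizedAlgorithm ((A n).analyst.Coins × Transcript (X n) (ℓ n)) ℝ,
    ∃ ν : ℕ → ℝ, Negligible ν ∧ ∀ n : ℕ,
      1 - ν n ≤ ((execution (A n) (empiricalMechanism (X n) n (ℓ n))).prod (F n).law).real
        {p | |(F n).run p.2 (Outcome.view p.1) - Outcome.target (hℓ n) p.1|
          ≤ (n : ℝ) ^ (-(1 / 10) : ℝ)}

/-- The last query fails every unbounded strategy: when the game is played with the empirical mean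
mechanism, every unbounded `G` that sees the transcript estimates the true value of the last query
up to `1/10` with probability at most `1/4` plus a negligible term. -/
def LastQueryUnpredictable (hℓ : ∀ n, 0 < ℓ n) (A : ∀ n, BalancedAdversary (X n) (ℓ n)) : Prop :=
  ∀ G : ∀ n, RandomizedAlgorithm (Transcript (X n) (ℓ n)) ℝ,
    ∃ ν : ℕ → ℝ, Negligible ν ∧ ∀ n : ℕ,
      ((execution (A n) (empiricalMechanism (X n) n (ℓ n))).prod (G n).law).real
        {p | |(G n).run p.2 (Outcome.transcript p.1) - Outcome.target (hℓ n) p.1| ≤ 1 / 10}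
        ≤ 1 / 4 + ν n

/-- Every unbounded mechanism that answers with the empirical mean before the last round, whatever
it does in the last round, fails on the last query with probability at least `3/4` up to a
negligible term. -/
def FailsLastRound (hℓ : ∀ n, 0 < ℓ n) (A : ∀ n, BalancedAdversary (X n) (ℓ n)) : Prop :=
  ∀ M : ∀ n, Mechanism (X n) n (ℓ n), (∀ n, (M n).EmpiricalBeforeLast) →
    ∃ ν : ℕ → ℝ, Negligible ν ∧ ∀ n : ℕ,
      3 / 4 - ν n ≤ (execution (A n) (M n)).real
        {e | 1 / 10 < |(Outcome.lastAnswer (hℓ n) e : ℝ) - Outcome.target (hℓ n) e|}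

end Structure

end ADA

end

/-!
The analyst gets no information from the sampler, so whatever it knows about the distribution is
already in the transcript. Indeed, when all answers are empirical means, the set of pairs (coins of
the analyst, samples) that lead to a given transcript `t` is a rectangle: the coins have to produce
the queries of `t` from its answers, and the samples have to give these answers as empirical means
of the queries (`play_eq_iff_consistent`). Hence the coins are independent of the seed and the
samples given `t`.

So an estimator that sees only the transcript can do as well as one that sees the view. The
estimator used here is `posteriorMean`, the mean of the true value of the last query over the seeds
and samples consistent with `t`. This avoids resampling the coins of the analyst, whose space need
not be standard Borel. For fixed coins there are finitely many transcripts, on each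
of which the average minimizes the mean square error, so `posteriorMean` is at least as good as the
extractor `F`, clipped to `[-1, 1]`
(`integral_posteriorMean_sub_sq_le_of_coins`). The error of `F` has mean square at most `ε² + 4 δ`
with `ε = n ^ (-1/10)` and `δ` negligible, and Chebyshev's inequality bounds the probability that
`posteriorMean` is off by more than `1/10` (`measureReal_posteriorMean_le`).

This contradicts unpredictability directly. It also contradicts failure in the last round: a
mechanism sees the queries and the samples, so it can compute the transcript of the empirical
mechanism and answer the last query by `posteriorMean` (`lastRoundMechanism`).
-/

namespace ADA

/-! ### Consistency and measurability of transcripts -/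

section Transcripts

variable {X : Type} [MeasurableSpace X] {n ℓ : ℕ}

/-- The samples `S` are consistent with the transcript `t`: every answer in `t` is the empirical
mean on `S` of the corresponding query. This does not involve the coins of the analyst. -/
def Consistent {k : ℕ} (t : Transcript X k) (S : Fin n → X) : Prop :=
  ∀ i, t.2 i = empiricalMean (t.1 i) S

theorem measurable_empiricalMean {X : Type} {n : ℕ} (S : Fin n → X) :
    Measurable fun q : Query X => empiricalMean q S := by
  refine Measurable.subtype_mk (Measurable.div_const ?_ _)
  exact Finset.measurable_sum _ fun j _ => measurable_subtype_coe.comp (measurable_pi_apply (S j))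

theorem measurable_snoc {α β : Type} [MeasurableSpace α] [MeasurableSpace β] {k : ℕ}
    {f : α → Fin k → β} {g : α → β} (hf : Measurable f) (hg : Measurable g) :
    Measurable fun a => (Fin.snoc (α := fun _ => β) (f a) (g a) : Fin (k + 1) → β) := by
  refine measurable_pi_lambda _ fun i => ?_
  refine Fin.lastCases ?_ (fun j => ?_) i
  · simpa using hg
  · simpa using (measurable_pi_apply j).fun_comp hf

theorem measurable_play (A : Analyst X ℓ) (M : Mechanism X n ℓ) (k : ℕ) (hk : k ≤ ℓ) :
    Measurable fun p : (Fin n → X) × A.Coins × M.Coins => play A M p.2.1 p.2.2 p.1 k hk := by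
  induction k with
  | zero => exact measurable_const
  | succ k ih =>
    have h := ih (Nat.le_of_succ_le hk)
    have hq := measurable_snoc (measurable_fst.comp h)
      ((A.measurable_query ⟨k, hk⟩).comp
        ((measurable_fst.comp measurable_snd).prodMk (measurable_snd.comp h)))
    have ha := (M.measurable_answer ⟨k, hk⟩).comp
      ((measurable_snd.comp measurable_snd).prodMk (measurable_fst.prodMk hq))
    exact hq.prodMk (measurable_snoc (measurable_snd.comp h) ha)

theorem trueMean_mem_Icc (q : Query X) (D : Measure X) [IsProbabilityMeasure D] :
    trueMean q D ∈ Set.Icc (-1 : ℝ) 1 := by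
  rw [Set.mem_Icc, ← abs_le]
  simpa [trueMean] using norm_integral_le_of_norm_le_const (μ := D) (f := fun x => (q x : ℝ)) (C := 1)
    (ae_of_all _ fun x => abs_le.2 (q x).2)

theorem measurable_transcript (A : BalancedAdversary X ℓ) (M : Mechanism X n ℓ) :
    Measurable fun e : Outcome A M => e.transcript :=
  (measurable_play A.analyst M ℓ le_rfl).comp
    ((measurable_snd.comp measurable_fst).prodMk measurable_snd)

variable [Finite X] [DiscreteMeasurableSpace X]

theorem consistent_play (A : Analyst X ℓ) (r : A.Coins) (c : Unit) (S : Fin n → X) (k : ℕ)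
    (hk : k ≤ ℓ) : Consistent (play A (empiricalMechanism X n ℓ) r c S k hk) S := by
  induction k with
  | zero => exact fun i => i.elim0
  | succ k ih =>
    intro i
    refine Fin.lastCases ?_ (fun j => ?_) i
    · simp [play, empiricalMechanism]
    · simpa [play] using ih (Nat.le_of_succ_le hk) j

/-- For fixed coins of the analyst, samples consistent with the transcript produced by `S` produce
the same transcript. -/
theorem play_eq_of_consistent (A : Analyst X ℓ) (r : A.Coins) (c : Unit) (S S' : Fin n → X)
    (k : ℕ) (hk : k ≤ ℓ) (h : Consistent (play A (empiricalMechanism X n ℓ) r c S k hk) S') :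
    play A (empiricalMechanism X n ℓ) r c S' k hk =
      play A (empiricalMechanism X n ℓ) r c S k hk := by
  induction k with
  | zero => rfl
  | succ k ih =>
    have h0 := ih (Nat.le_of_succ_le hk) fun j => by simpa [play] using h j.castSucc
    have h1 := h (Fin.last k)
    simp only [play, Fin.snoc_last] at h1
    simp only [play, h0, h1]
    simp [empiricalMechanism]

theorem play_eq_iff_consistent (A : Analyst X ℓ) (r : A.Coins) (c : Unit) (S S' : Fin n → X) :
    play A (empiricalMechanism X n ℓ) r c S' ℓ le_rfl =
        play A (empiricalMechanism X n ℓ) r c S ℓ le_rfl ↔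
      Consistent (play A (empiricalMechanism X n ℓ) r c S ℓ le_rfl) S' :=
  ⟨fun h => h ▸ consistent_play A r c S' ℓ le_rfl, play_eq_of_consistent A r c S S' ℓ le_rfl⟩

theorem measurableSet_consistent {k : ℕ} :
    MeasurableSet {p : Transcript X k × (Fin n → X) | Consistent p.1 p.2} := by
  have h : Measurable fun p : Transcript X k × (Fin n → X) => Consistent p.1 p.2 := by
    refine measurable_from_prod_countable_left fun S => ?_
    refine Measurable.forall fun i => ?_
    refine measurableSet_setOfPred.1 (measurableSet_eq_fun ?_ ?_)
    · exact (measurable_pi_apply i).comp measurable_snd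
    · exact (measurable_empiricalMean S).comp ((measurable_pi_apply i).comp measurable_fst)
  exact measurableSet_setOfPred.2 h

theorem trueMean_eq_sum [Fintype X] (q : Query X) (D : Measure X) [IsFiniteMeasure D] :
    trueMean q D = ∑ x, D.real {x} * (q x : ℝ) := by
  simp [trueMean, integral_fintype (Integrable.of_finite)]

theorem measurable_trueMean {Ω : Type} [MeasurableSpace Ω] (κ : Kernel Ω X) [IsMarkovKernel κ] :
    Measurable fun p : Query X × Ω => trueMean p.1 (κ p.2) := by
  have := Fintype.ofFinite X
  simp only [trueMean_eq_sum]
  refine Finset.measurable_sum _ fun x _ => Measurable.mul ?_ ?_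
  · exact (κ.measurable_coe (measurableSet_singleton x)).ennreal_toReal.comp measurable_snd
  · exact measurable_subtype_coe.comp ((measurable_pi_apply x).comp measurable_fst)

theorem measurable_target (hℓ : 0 < ℓ) (A : BalancedAdversary X ℓ) (M : Mechanism X n ℓ) :
    Measurable fun e : Outcome A M => e.target hℓ :=
  (measurable_trueMean A.sampler.dist).comp
    (((measurable_pi_apply _).comp (measurable_fst.comp (measurable_transcript A M))).prodMk
      (measurable_fst.comp measurable_fst))

end Transcripts

/-! ### Least squares over a finite partition -/

section LeastSquares

/-- The average minimizes the mean square error among constants. -/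
theorem integral_average_sub_sq_le {α : Type} [MeasurableSpace α] (μ : Measure α)
    [IsFiniteMeasure μ] {U : α → ℝ} (hU : Integrable U μ) (hU2 : Integrable (fun a => U a ^ 2) μ)
    (c : ℝ) : ∫ a, ((⨍ b, U b ∂μ) - U a) ^ 2 ∂μ ≤ ∫ a, (c - U a) ^ 2 ∂μ := by
  have key : ∀ d : ℝ, ∫ a, (d - U a) ^ 2 ∂μ
      = d ^ 2 * μ.real Set.univ - 2 * d * ∫ a, U a ∂μ + ∫ a, U a ^ 2 ∂μ := by
    intro d
    have h1 : ∀ a, (d - U a) ^ 2 = d ^ 2 - 2 * d * U a + U a ^ 2 := fun a => by ring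
    simp_rw [h1]
    rw [integral_add (f := fun a => d ^ 2 - 2 * d * U a)
        ((integrable_const _).sub (hU.const_mul _)) hU2,
      integral_sub (integrable_const _) (hU.const_mul _), integral_const_mul, integral_const]
    simp [mul_comm]
  have havg : μ.real Set.univ * (⨍ b, U b ∂μ) = ∫ b, U b ∂μ := by
    simpa using measure_smul_average μ U
  rw [key, key, ← havg]
  nlinarith [mul_nonneg (measureReal_nonneg (μ := μ) (s := Set.univ))
    (sq_nonneg (c - ⨍ b, U b ∂μ))]

/-- Comparison of two integrals over a partition into finitely many fibres. -/
theorem integral_le_integral_of_fiber_le {α β : Type} [MeasurableSpace α] (μ : Measure α)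
    {T : α → β} (hT : (Set.range T).Finite) (hm : ∀ a, MeasurableSet (T ⁻¹' {T a}))
    {u v : α → ℝ} (hu : Integrable u μ) (hv : Integrable v μ)
    (h : ∀ a, ∫ b in T ⁻¹' {T a}, u b ∂μ ≤ ∫ b in T ⁻¹' {T a}, v b ∂μ) :
    ∫ a, u a ∂μ ≤ ∫ a, v a ∂μ := by
  have cover : ⋃ t ∈ hT.toFinset, T ⁻¹' {t} = Set.univ := by ext a; simp
  have split : ∀ w : α → ℝ, Integrable w μ →
      ∫ a, w a ∂μ = ∑ t ∈ hT.toFinset, ∫ a in T ⁻¹' {t}, w a ∂μ := by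
    intro w hw
    rw [← integral_biUnion_finset, cover, setIntegral_univ]
    · intro t ht
      obtain ⟨a, rfl⟩ := hT.mem_toFinset.1 ht
      exact hm a
    · intro s _ t _ hst
      exact Disjoint.preimage T (Set.disjoint_singleton.2 hst)
    · exact fun _ _ => hw.integrableOn
  rw [split u hu, split v hv]
  refine Finset.sum_le_sum fun t ht => ?_
  obtain ⟨a, rfl⟩ := hT.mem_toFinset.1 ht
  exact h a

theorem integral_prod_le_of_forall_le {α β : Type} [MeasurableSpace α] [MeasurableSpace β]
    (μ : Measure α) (ν : Measure β) [IsFiniteMeasure μ] [IsFiniteMeasure ν]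
    {u v : α × β → ℝ} (hu : Integrable u (μ.prod ν)) (hv : Integrable v (μ.prod ν))
    (h : ∀ b, ∫ a, u (a, b) ∂μ ≤ ∫ a, v (a, b) ∂μ) :
    ∫ p, u p ∂(μ.prod ν) ≤ ∫ p, v p ∂(μ.prod ν) := by
  rw [integral_prod_symm u hu, integral_prod_symm v hv]
  exact integral_mono hu.integral_prod_right hv.integral_prod_right h

end LeastSquares

/-! ### The posterior mean -/

section Estimator

variable {X : Type} [MeasurableSpace X] {n ℓ : ℕ}

/-- The mean of the true value of the last query under the posterior law of the sampler's seed and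
the samples, given the transcript `t`: the average over all pairs of a seed and samples that are
consistent with `t`. The projection to `[-1, 1]` only serves to make it an `Answer`. If the consistent pairs have
probability zero, the value is the junk value `0`, which occurs with probability zero. -/
noncomputable def posteriorMean (n : ℕ) (hℓ : 0 < ℓ) (B : Sampler X) (t : Transcript X ℓ) :
    Answer :=
  Set.projIcc (-1) 1 (by norm_num)
    (⨍ w in {w : B.Seed × (Fin n → X) | Consistent t w.2},
      trueMean (t.1 ⟨ℓ - 1, Nat.sub_one_lt_of_lt hℓ⟩) (B.dist w.1) ∂(B.law ⊗ₘ iid B.dist n))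

theorem abs_projIcc_sub_le (a : ℝ) {u : ℝ} (hu : u ∈ Set.Icc (-1 : ℝ) 1) :
    |(Set.projIcc (-1) 1 (by norm_num) a : ℝ) - u| ≤ |a - u| := by
  have h := Set.abs_projIcc_sub_projIcc (a := (-1 : ℝ)) (b := 1) (c := a) (d := u) (by norm_num)
  rwa [Set.projIcc_of_mem _ hu] at h

theorem abs_answer_sub_le (y : Answer) {u : ℝ} (hu : u ∈ Set.Icc (-1 : ℝ) 1) :
    |(y : ℝ) - u| ≤ 2 := by
  have := y.2.1
  have := y.2.2
  have := hu.1
  have := hu.2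
  rw [abs_le]
  constructor <;> linarith

theorem sq_answer_sub_le (y : Answer) {u : ℝ} (hu : u ∈ Set.Icc (-1 : ℝ) 1) :
    ((y : ℝ) - u) ^ 2 ≤ 4 := by
  rw [← sq_abs]
  nlinarith [abs_answer_sub_le y hu, abs_nonneg ((y : ℝ) - u)]

theorem integrable_sq_answer_sub {α : Type} [MeasurableSpace α] (μ : Measure α)
    [IsFiniteMeasure μ] {y : α → Answer} {U : α → ℝ} (hy : Measurable y) (hU : Measurable U)
    (hU1 : ∀ a, U a ∈ Set.Icc (-1 : ℝ) 1) : Integrable (fun a => ((y a : ℝ) - U a) ^ 2) μ := by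
  refine Integrable.of_bound
    (((measurable_subtype_coe.comp hy).sub hU).pow_const 2).aestronglyMeasurable 4
    (ae_of_all _ fun a => ?_)
  rw [Real.norm_of_nonneg (sq_nonneg _)]
  exact sq_answer_sub_le _ (hU1 a)

theorem integrable_of_mem_Icc {α : Type} [MeasurableSpace α] (μ : Measure α)
    [IsFiniteMeasure μ] {U : α → ℝ} (hU : Measurable U)
    (hU1 : ∀ a, U a ∈ Set.Icc (-1 : ℝ) 1) : Integrable U μ :=
  Integrable.of_bound hU.aestronglyMeasurable 1 (ae_of_all _ fun a => abs_le.2 (hU1 a))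

variable [Finite X] [DiscreteMeasurableSpace X]

theorem measurable_posteriorMean (n : ℕ) (hℓ : 0 < ℓ) (B : Sampler X) :
    Measurable (posteriorMean n hℓ B) := by
  have hC : MeasurableSet {p : Transcript X ℓ × (B.Seed × (Fin n → X)) | Consistent p.1 p.2.2} :=
    measurableSet_consistent.preimage
      (measurable_fst.prodMk (measurable_snd.comp measurable_snd))
  have hC' : ∀ t : Transcript X ℓ,
      MeasurableSet {w : B.Seed × (Fin n → X) | Consistent t w.2} := fun t =>
    hC.preimage measurable_prodMk_left
  refine continuous_projIcc.measurable.comp ?_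
  simp only [setAverage_eq, smul_eq_mul]
  refine Measurable.mul (Measurable.inv ?_) ?_
  · exact (measurable_measure_prodMk_left hC).ennreal_toReal
  · simp_rw [← integral_indicator (hC' _)]
    refine (StronglyMeasurable.integral_prod_right (f := fun (t : Transcript X ℓ)
      (w : B.Seed × (Fin n → X)) => {w : B.Seed × (Fin n → X) | Consistent t w.2}.indicator
        (fun w => trueMean (t.1 ⟨ℓ - 1, Nat.sub_one_lt_of_lt hℓ⟩) (B.dist w.1)) w)
      (Measurable.stronglyMeasurable ?_)).measurable
    refine Measurable.indicator (s := {p : Transcript X ℓ × (B.Seed × (Fin n → X)) |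
      Consistent p.1 p.2.2}) (f := fun p => trueMean (p.1.1 ⟨ℓ - 1, Nat.sub_one_lt_of_lt hℓ⟩)
        (B.dist p.2.1)) ?_ hC
    have hq : Measurable fun p : Transcript X ℓ × (B.Seed × (Fin n → X)) =>
        p.1.1 ⟨ℓ - 1, Nat.sub_one_lt_of_lt hℓ⟩ :=
      (measurable_pi_apply (X := fun _ : Fin ℓ => Query X) _).comp
        (measurable_fst.comp measurable_fst)
    exact (measurable_trueMean B.dist).comp
      (hq.prodMk (measurable_fst.comp measurable_snd))

/-- For fixed coins of the analyst, the posterior mean has the least mean square error among all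
functions of the transcript. It does not depend on these coins because the set of samples that
lead to a given transcript does not. -/
theorem integral_posteriorMean_sub_sq_le_of_coins (hℓ : 0 < ℓ) (A : BalancedAdversary X ℓ)
    (y : Transcript X ℓ → Answer) (hy : Measurable y)
    (r : A.analyst.Coins × (empiricalMechanism X n ℓ).Coins) :
    ∫ w, ((posteriorMean n hℓ A.sampler
        (Outcome.transcript (M := empiricalMechanism X n ℓ) (w, r)) : ℝ)
          - Outcome.target (M := empiricalMechanism X n ℓ) hℓ (w, r)) ^ 2
        ∂(A.sampler.law ⊗ₘ iid A.sampler.dist n) ≤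
      ∫ w, ((y (Outcome.transcript (M := empiricalMechanism X n ℓ) (w, r)) : ℝ)
          - Outcome.target (M := empiricalMechanism X n ℓ) hℓ (w, r)) ^ 2
        ∂(A.sampler.law ⊗ₘ iid A.sampler.dist n) := by
  set μ := A.sampler.law ⊗ₘ iid A.sampler.dist n
  set T : A.sampler.Seed × (Fin n → X) → Transcript X ℓ := fun w =>
    Outcome.transcript (A := A) (M := empiricalMechanism X n ℓ) (w, r) with hT
  have hTm : Measurable T := (measurable_transcript A _).comp measurable_prodMk_right
  have hUm : Measurable fun w =>
      Outcome.target (A := A) (M := empiricalMechanism X n ℓ) hℓ (w, r) :=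
    (measurable_target hℓ A _).comp measurable_prodMk_right
  have hU1 : ∀ w, Outcome.target (A := A) (M := empiricalMechanism X n ℓ) hℓ (w, r) ∈
      Set.Icc (-1 : ℝ) 1 := fun w => trueMean_mem_Icc _ (A.sampler.dist w.1)
  have hfib : ∀ w, T ⁻¹' {T w} = {w' | Consistent (T w) w'.2} := fun w => by
    ext w'
    exact play_eq_iff_consistent A.analyst r.1 r.2 w.2 w'.2
  have hfibm : ∀ w, MeasurableSet (T ⁻¹' {T w}) := fun w => by
    rw [hfib]
    exact measurableSet_consistent.preimage (measurable_const.prodMk measurable_snd)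
  refine integral_le_integral_of_fiber_le μ (T := T) ?_ hfibm
    (integrable_sq_answer_sub μ ((measurable_posteriorMean n hℓ A.sampler).comp hTm) hUm hU1)
    (integrable_sq_answer_sub μ (hy.comp hTm) hUm hU1) fun w => ?_
  · refine (Set.finite_range fun S : Fin n → X => play A.analyst (empiricalMechanism X n ℓ)
      r.1 r.2 S ℓ le_rfl).subset ?_
    rintro _ ⟨w, rfl⟩
    exact ⟨w.2, rfl⟩
  · set V : A.sampler.Seed × (Fin n → X) → ℝ := fun w' =>
      trueMean ((T w).1 ⟨ℓ - 1, Nat.sub_one_lt_of_lt hℓ⟩) (A.sampler.dist w'.1) with hV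
    have hVm : Measurable V := (measurable_trueMean A.sampler.dist).comp
      (measurable_const.prodMk measurable_fst)
    have hV1 : ∀ w', V w' ∈ Set.Icc (-1 : ℝ) 1 := fun w' =>
      trueMean_mem_Icc _ (A.sampler.dist w'.1)
    have hVi : Integrable V (μ.restrict (T ⁻¹' {T w})) := integrable_of_mem_Icc _ hVm hV1
    have hVi2 : Integrable (fun w' => V w' ^ 2) (μ.restrict (T ⁻¹' {T w})) := by
      simpa using integrable_sq_answer_sub (μ.restrict (T ⁻¹' {T w})) 
        (y := fun _ => ⟨0, by norm_num⟩)
        measurable_const hVm hV1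
    -- on the fibre of `T w` the transcript, and with it the last query, is constant
    have hcongr : ∀ z : Transcript X ℓ → Answer,
        ∫ w' in T ⁻¹' {T w}, ((z (T w') : ℝ)
          - Outcome.target (M := empiricalMechanism X n ℓ) hℓ (w', r)) ^ 2 ∂μ =
        ∫ w' in T ⁻¹' {T w}, ((z (T w) : ℝ) - V w') ^ 2 ∂μ := fun z =>
      setIntegral_congr_fun (hfibm w) fun w' hw' => by
        have hw' : T w' = T w := hw'
        have h2 : Outcome.target (M := empiricalMechanism X n ℓ) hℓ (w', r) = V w' := by
          rw [hV]
          dsimp only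
          rw [← hw']
          rfl
        simp only [hw', h2]
    refine (hcongr _).trans_le (le_trans ?_ (hcongr y).ge)
    refine le_trans ?_ (integral_average_sub_sq_le _ hVi hVi2 (y (T w)))
    refine integral_mono (integrable_sq_answer_sub _ measurable_const hVm hV1) ?_ fun w' => ?_
    · have h1 : ∀ a v : ℝ, (a - v) ^ 2 = a ^ 2 - 2 * a * v + v ^ 2 := fun a v => by ring
      simp only [h1]
      exact ((integrable_const _).sub (hVi.const_mul _)).add hVi2
    · refine sq_le_sq.2 ?_
      rw [hfib]
      exact abs_projIcc_sub_le _ (hV1 w')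

/-- If some randomized algorithm knows the true value of the last query up to `ε`, except with
probability `δ`, from the view of the analyst, then the posterior mean, which is a function of
the transcript alone, misses it by more than `1 / 10` with small probability. -/
theorem measureReal_posteriorMean_le (hℓ : 0 < ℓ) (A : BalancedAdversary X ℓ)
    (F : RandomizedAlgorithm (A.analyst.Coins × Transcript X ℓ) ℝ) {ε δ : ℝ}
    (hF : 1 - δ ≤ ((execution A (empiricalMechanism X n ℓ)).prod F.law).real
        {p | |F.run p.2 (Outcome.view p.1) - Outcome.target hℓ p.1| ≤ ε}) :
    (execution A (empiricalMechanism X n ℓ)).real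
        {e | 1 / 10 < |(posteriorMean n hℓ A.sampler e.transcript : ℝ) - e.target hℓ|} ≤
      100 * (ε ^ 2 + 4 * δ) := by
  have : IsProbabilityMeasure (execution A (empiricalMechanism X n ℓ)) := by
    unfold execution; infer_instance
  set P := execution A (empiricalMechanism X n ℓ) with hP
  set U : Outcome A (empiricalMechanism X n ℓ) → ℝ := fun e => e.target hℓ with hU
  have hUm : Measurable U := measurable_target hℓ A _
  have hU1 : ∀ e, U e ∈ Set.Icc (-1 : ℝ) 1 := fun e =>
    trueMean_mem_Icc _ (A.sampler.dist e.1.1)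
  have hTm := measurable_transcript A (empiricalMechanism X n ℓ)
  set m : Outcome A (empiricalMechanism X n ℓ) → Answer := fun e =>
    posteriorMean n hℓ A.sampler e.transcript with hm
  have hmm : Measurable m := (measurable_posteriorMean n hℓ A.sampler).comp hTm
  set f : Outcome A (empiricalMechanism X n ℓ) × F.Coins → ℝ := fun p =>
    F.run p.2 (Outcome.view p.1) with hf
  have hfm : Measurable f := F.measurable_run.comp (measurable_snd.prodMk
    (((measurable_fst.comp measurable_snd).prodMk hTm).comp measurable_fst))
  set y : Outcome A (empiricalMechanism X n ℓ) × F.Coins → Answer := fun p =>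
    Set.projIcc (-1) 1 (by norm_num) (f p) with hy
  have hym : Measurable y := continuous_projIcc.measurable.comp hfm
  have hint : Integrable (fun p : Outcome A (empiricalMechanism X n ℓ) × F.Coins =>
      ((y p : ℝ) - U p.1) ^ 2) (P.prod F.law) :=
    integrable_sq_answer_sub _ hym (hUm.comp measurable_fst) fun p => hU1 p.1
  -- the posterior mean is at least as good as the clipped output of `F`, in mean square
  have hcomp : ∫ e, ((m e : ℝ) - U e) ^ 2 ∂P ≤
      ∫ p, ((y p : ℝ) - U p.1) ^ 2 ∂(P.prod F.law) := by
    have h1 : ∫ e, ((m e : ℝ) - U e) ^ 2 ∂P =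
        ∫ p, ((m p.1 : ℝ) - U p.1) ^ 2 ∂(P.prod F.law) := by
      rw [integral_fun_fst (f := fun e => ((m e : ℝ) - U e) ^ 2)]
      simp
    rw [h1]
    refine integral_prod_le_of_forall_le P F.law
      (integrable_sq_answer_sub _ (hmm.comp measurable_fst) (hUm.comp measurable_fst)
        fun p => hU1 p.1) hint fun c => ?_
    refine integral_prod_le_of_forall_le (A.sampler.law ⊗ₘ iid A.sampler.dist n)
      (A.analyst.law.prod (empiricalMechanism X n ℓ).law)
      (integrable_sq_answer_sub _ hmm hUm hU1)
      (integrable_sq_answer_sub _ (hym.comp measurable_prodMk_right) hUm hU1) fun r => ?_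
    exact integral_posteriorMean_sub_sq_le_of_coins hℓ A
      (fun t => Set.projIcc (-1) 1 (by norm_num) (F.run c (r.1, t)))
      ((continuous_projIcc (h := by norm_num)).measurable.comp (F.measurable_run.comp
        (measurable_const.prodMk (measurable_const.prodMk measurable_id)))) r
  have hgood : MeasurableSet {p | |f p - U p.1| ≤ ε} :=
    measurableSet_le (continuous_abs.measurable.comp (hfm.sub (hUm.comp measurable_fst)))
      measurable_const
  have hupper : ∫ p, ((y p : ℝ) - U p.1) ^ 2 ∂(P.prod F.law) ≤ ε ^ 2 + 4 * δ := by
    have hbad : (P.prod F.law).real {p | |f p - U p.1| ≤ ε}ᶜ ≤ δ := by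
      rw [probReal_compl_eq_one_sub hgood]
      linarith
    have hpt : ∀ p, ((y p : ℝ) - U p.1) ^ 2 ≤
        ε ^ 2 + {p | |f p - U p.1| ≤ ε}ᶜ.indicator (fun _ => (4 : ℝ)) p := by
      intro p
      by_cases hp : |f p - U p.1| ≤ ε
      · rw [Set.indicator_of_notMem (by simpa using hp), add_zero, ← sq_abs]
        exact pow_le_pow_left₀ (abs_nonneg _)
          ((abs_projIcc_sub_le (f p) (hU1 p.1)).trans hp) 2
      · rw [Set.indicator_of_mem (by simpa using hp)]
        nlinarith [sq_answer_sub_le (y p) (hU1 p.1), sq_nonneg ε]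
    have hi : Integrable ({p | |f p - U p.1| ≤ ε}ᶜ.indicator (fun _ => (4 : ℝ)))
        (P.prod F.law) := (integrable_const _).indicator hgood.compl
    refine (integral_mono hint ((integrable_const _).add hi) hpt).trans ?_
    rw [integral_add' (integrable_const _) hi, integral_indicator_const _ hgood.compl]
    simp only [integral_const, probReal_univ, smul_eq_mul, one_mul]
    linarith
  have hcheb := mul_meas_ge_le_integral_of_nonneg (μ := P)
    (f := fun e => ((m e : ℝ) - U e) ^ 2) (ae_of_all _ fun e => sq_nonneg _)
    (integrable_sq_answer_sub _ hmm hUm hU1) (1 / 100)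
  have hsub : P.real {e | 1 / 10 < |(m e : ℝ) - U e|} ≤
      P.real {e | 1 / 100 ≤ ((m e : ℝ) - U e) ^ 2} := by
    refine measureReal_mono fun e he => ?_
    have he : 1 / 10 < |(m e : ℝ) - U e| := he
    show 1 / 100 ≤ ((m e : ℝ) - U e) ^ 2
    rw [← sq_abs]
    nlinarith
  linarith

end Estimator

/-! ### A mechanism that deviates in the last round only -/

section LastRound

variable {X : Type} [MeasurableSpace X] [Finite X] [DiscreteMeasurableSpace X] {n ℓ : ℕ}

/-- The mechanism that answers with the empirical mean before the last round, and with `g t` in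
the last round, where `t` is the transcript in which all answers, also the last one, are empirical
means. -/
noncomputable def lastRoundMechanism (n : ℕ) (g : Transcript X ℓ → Answer) (hg : Measurable g) :
    Mechanism X n ℓ where
  Coins := Unit
  law := Measure.dirac ()
  answer i _ S qs :=
    if h : i.val + 1 < ℓ then empiricalMean (qs (Fin.last i.val)) S
    else g (fun j => qs (Fin.castLE (not_lt.1 h) j),
      fun j => empiricalMean (qs (Fin.castLE (not_lt.1 h) j)) S)
  isProbabilityMeasure_law := Measure.dirac.isProbabilityMeasure
  measurable_answer i := by
    by_cases h : i.val + 1 < ℓ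
    · simp only [dif_pos h]
      exact (empiricalMechanism X n ℓ).measurable_answer i
    · simp only [dif_neg h]
      have h1 : Measurable fun p : (Fin (i.val + 1) → Query X) × (Fin n → X) =>
          g (fun j => p.1 (Fin.castLE (not_lt.1 h) j),
            fun j => empiricalMean (p.1 (Fin.castLE (not_lt.1 h) j)) p.2) := by
        refine measurable_from_prod_countable_left fun S => hg.comp (Measurable.prodMk ?_ ?_)
        · exact measurable_pi_lambda _ fun j => measurable_pi_apply _
        · exact measurable_pi_lambda _ fun j =>
            (measurable_empiricalMean S).comp (measurable_pi_apply _)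
      exact h1.comp ((measurable_snd.comp measurable_snd).prodMk
        (measurable_fst.comp measurable_snd))

theorem empiricalBeforeLast_lastRoundMechanism (g : Transcript X ℓ → Answer)
    (hg : Measurable g) : (lastRoundMechanism n g hg).EmpiricalBeforeLast :=
  fun _ hi _ _ _ => dif_pos hi

theorem play_lastRoundMechanism (A : Analyst X ℓ) (g : Transcript X ℓ → Answer)
    (hg : Measurable g) (r : A.Coins) (c : Unit) (S : Fin n → X) (k : ℕ) (hk : k < ℓ) :
    play A (lastRoundMechanism n g hg) r c S k hk.le =
      play A (empiricalMechanism X n ℓ) r c S k hk.le := by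
  induction k with
  | zero => rfl
  | succ k ih =>
    have h0 := ih (Nat.lt_of_succ_lt hk)
    simp only [play, h0]
    simp [lastRoundMechanism, empiricalMechanism, hk]

theorem queries_lastRoundMechanism (A : Analyst X ℓ) (g : Transcript X ℓ → Answer)
    (hg : Measurable g) (r : A.Coins) (c : Unit) (S : Fin n → X) :
    (play A (lastRoundMechanism n g hg) r c S ℓ le_rfl).1 =
      (play A (empiricalMechanism X n ℓ) r c S ℓ le_rfl).1 := by
  cases ℓ with
  | zero => rfl
  | succ k => simp only [play, play_lastRoundMechanism A g hg r c S k k.lt_succ_self]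

theorem lastAnswer_lastRoundMechanism (hℓ : 0 < ℓ) (A : Analyst X ℓ)
    (g : Transcript X ℓ → Answer) (hg : Measurable g) (r : A.Coins) (c : Unit) (S : Fin n → X) :
    (play A (lastRoundMechanism n g hg) r c S ℓ le_rfl).2 ⟨ℓ - 1, Nat.sub_one_lt_of_lt hℓ⟩ =
      g (play A (empiricalMechanism X n ℓ) r c S ℓ le_rfl) := by
  have hq := queries_lastRoundMechanism A g hg r c S
  have hc : (fun i => empiricalMean ((play A (empiricalMechanism X n ℓ) r c S ℓ le_rfl).1 i) S) =
      (play A (empiricalMechanism X n ℓ) r c S ℓ le_rfl).2 :=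
    funext fun i => (consistent_play A r c S ℓ le_rfl i).symm
  cases ℓ with
  | zero => exact absurd hℓ (lt_irrefl 0)
  | succ k =>
    have h1 : (play A (lastRoundMechanism n g hg) r c S (k + 1) le_rfl).2 (Fin.last k) =
        (lastRoundMechanism n g hg).answer (Fin.last k) c S
          (play A (lastRoundMechanism n g hg) r c S (k + 1) le_rfl).1 :=
      Fin.snoc_last (α := fun _ => Answer) _ _
    refine h1.trans ?_
    rw [hq]
    have h2 : ¬ (Fin.last k).val + 1 < k + 1 := lt_irrefl _
    refine (dif_neg h2).trans (congrArg g (Prod.ext rfl ?_))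
    exact hc

end LastRound

/-! ### Asymptotics -/

theorem Negligible.eventually_lt {ν : ℕ → ℝ} (hν : Negligible ν) {c : ℝ} (hc : 0 < c) :
    ∀ᶠ n in atTop, ν n < c := by
  have h := (tendsto_rpow_neg_atTop one_pos).comp (tendsto_natCast_atTop_atTop (R := ℝ))
  filter_upwards [hν 1 one_pos, h.eventually_lt_const hc] with n h1 h2
  exact h1.trans h2

section Adversary

variable {X : ℕ → Type} [∀ n, MeasurableSpace (X n)] [∀ n, Finite (X n)]
  [∀ n, DiscreteMeasurableSpace (X n)] {ℓ : ℕ → ℕ}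

/-- A function of the transcript alone estimates the last true value, with high probability. -/
theorem KnowsLastValue.eventually_posteriorMean {hℓ : ∀ n, 0 < ℓ n}
    {A : ∀ n, BalancedAdversary (X n) (ℓ n)} (h : KnowsLastValue hℓ A) :
    ∀ᶠ n in atTop, (execution (A n) (empiricalMechanism (X n) n (ℓ n))).real
        {e | 1 / 10 < |(posteriorMean n (hℓ n) (A n).sampler e.transcript : ℝ)
          - e.target (hℓ n)|} < 1 / 2 := by
  obtain ⟨F, ν, hν, hF⟩ := h
  have hε : Tendsto (fun n : ℕ => ((n : ℝ) ^ (-(1 / 10) : ℝ)) ^ 2) atTop (nhds 0) := by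
    simpa using (((tendsto_rpow_neg_atTop (y := 1 / 10) (by norm_num)).comp
      tendsto_natCast_atTop_atTop).pow 2)
  filter_upwards [hν.eventually_lt (c := 1 / 2000) (by norm_num),
    hε.eventually_lt_const (u := 1 / 1000) (by norm_num)] with n h1 h2
  linarith [measureReal_posteriorMean_le (hℓ n) (A n) (F n) (hF n)]

theorem KnowsLastValue.not_lastQueryUnpredictable {hℓ : ∀ n, 0 < ℓ n}
    {A : ∀ n, BalancedAdversary (X n) (ℓ n)} (h : KnowsLastValue hℓ A) :
    ¬ LastQueryUnpredictable hℓ A := by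
  intro h2
  obtain ⟨ν, hν, hG⟩ := h2 fun n =>
    { Coins := Unit
      law := Measure.dirac ()
      isProbabilityMeasure_law := Measure.dirac.isProbabilityMeasure
      run := fun _ t => (posteriorMean n (hℓ n) (A n).sampler t : ℝ)
      measurable_run := measurable_subtype_coe.comp
        ((measurable_posteriorMean n (hℓ n) (A n).sampler).comp measurable_snd) }
  obtain ⟨n, h1, h3⟩ := (h.eventually_posteriorMean.and
    (hν.eventually_lt (c := 1 / 4) (by norm_num))).exists
  have h4 := hG n
  have : IsProbabilityMeasure (execution (A n) (empiricalMechanism (X n) n (ℓ n))) := by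
    unfold execution; infer_instance
  have hmeas : MeasurableSet {e : Outcome (A n) (empiricalMechanism (X n) n (ℓ n)) |
      1 / 10 < |(posteriorMean n (hℓ n) (A n).sampler e.transcript : ℝ) - e.target (hℓ n)|} :=
    measurableSet_lt measurable_const (continuous_abs.measurable.comp
      ((measurable_subtype_coe.comp ((measurable_posteriorMean n (hℓ n) (A n).sampler).comp
        (measurable_transcript _ _))).sub (measurable_target _ _ _)))
  have h5 := (measurePreserving_fst (μ := execution (A n) (empiricalMechanism (X n) n (ℓ n)))
    (ν := Measure.dirac ())).measureReal_preimage hmeas.compl.nullMeasurableSet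
  rw [probReal_compl_eq_one_sub hmeas] at h5
  simp only [Set.preimage_ofPred_eq, Set.compl_ofPred, not_lt] at h5
  linarith

theorem KnowsLastValue.not_failsLastRound {hℓ : ∀ n, 0 < ℓ n}
    {A : ∀ n, BalancedAdversary (X n) (ℓ n)} (h : KnowsLastValue hℓ A) :
    ¬ FailsLastRound hℓ A := by
  intro h2
  obtain ⟨ν, hν, hM⟩ := h2
    (fun n => lastRoundMechanism n _ (measurable_posteriorMean n (hℓ n) (A n).sampler))
    fun n => empiricalBeforeLast_lastRoundMechanism _ _
  obtain ⟨n, h1, h3⟩ := (h.eventually_posteriorMean.and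
    (hν.eventually_lt (c := 1 / 4) (by norm_num))).exists
  have h4 := hM n
  set g := posteriorMean n (hℓ n) (A n).sampler
  have hg : Measurable g := measurable_posteriorMean n (hℓ n) (A n).sampler
  -- both mechanisms have the same trivial coins, so the two executions have the same law
  have h5 : (execution (A n) (lastRoundMechanism n g hg)).real
        {e | 1 / 10 < |(Outcome.lastAnswer (hℓ n) e : ℝ) - Outcome.target (hℓ n) e|} =
      (execution (A n) (empiricalMechanism (X n) n (ℓ n))).real
        {e | 1 / 10 < |(g e.transcript : ℝ) - e.target (hℓ n)|} := by
    refine congrArg (execution (A n) (empiricalMechanism (X n) n (ℓ n))).real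
      (Set.ext fun e => ?_)
    have ha := lastAnswer_lastRoundMechanism (hℓ n) (A n).analyst g hg e.2.1 e.2.2 e.1.2
    have hq := congrFun (queries_lastRoundMechanism (A n).analyst g hg e.2.1 e.2.2 e.1.2)
      ⟨ℓ n - 1, Nat.sub_one_lt_of_lt (hℓ n)⟩
    have ht : Outcome.target (M := lastRoundMechanism n g hg) (hℓ n) e =
        Outcome.target (M := empiricalMechanism (X n) n (ℓ n)) (hℓ n) e :=
      congrArg (fun q => trueMean q ((A n).sampler.dist e.1.1)) hq
    have ha' : Outcome.lastAnswer (M := lastRoundMechanism n g hg) (hℓ n) e =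
        g (Outcome.transcript (M := empiricalMechanism (X n) n (ℓ n)) e) := ha
    show 1 / 10 < |(Outcome.lastAnswer (M := lastRoundMechanism n g hg) (hℓ n) e : ℝ) -
      Outcome.target (M := lastRoundMechanism n g hg) (hℓ n) e| ↔ _
    rw [ha', ht]
    rfl
  linarith

end Adversary

end ADA

theorem mainTheorem6 (X : ℕ → Type) [∀ n, MeasurableSpace (X n)] [∀ n, Finite (X n)]
    [∀ n, DiscreteMeasurableSpace (X n)] (ℓ : ℕ → ℕ) (hℓ : ∀ n, 0 < ℓ n) :
    (¬ ∃ A : ∀ n, ADA.BalancedAdversary (X n) (ℓ n),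
      ADA.KnowsLastValue hℓ A ∧ ADA.LastQueryUnpredictable hℓ A) ∧
    (¬ ∃ A : ∀ n, ADA.BalancedAdversary (X n) (ℓ n),
      ADA.KnowsLastValue hℓ A ∧ ADA.FailsLastRound hℓ A) :=
  ⟨fun ⟨_, h, h'⟩ => h.not_lastQueryUnpredictable h', fun ⟨_, h, h'⟩ => h.not_failsLastRound h'⟩
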